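/- For $n=0,1,2,\ldots$ let $A_n=\sum_{k=0}^n\binom nk^2\binom{n+k}k^2$ be the $n$-th Apéry number. Let $p>3$ be a prime. Then $$\sum_{k=0}^{p-1}(2k+1)^3(-1)^kA_k\equiv-\frac p3\cdot\left(\frac p3\right)\pmod{p^3},$$ where in the product on the right-hand side the first factor $\frac p3$ is the rational number $p/3$ and the second factor $\left(\frac p3\right)$ is the Legendre symbol. Here, for rational numbers $a,b$, the congruence $a\equiv b\pmod{p^3}$ means that $a-b=p^3r$ for some rational number $r$ whose denominator in lowest terms is not divisible by $p$. -/

import Mathlib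

/-- The Apéry number `A_n = ∑_{k=0}^n C(n,k)^2 C(n+k,k)^2`. -/
def aperyNumber (n : ℕ) : ℕ :=
  ∑ k ∈ Finset.range (n + 1), n.choose k ^ 2 * (n + k).choose k ^ 2

/-- Congruence of rational numbers modulo the power `p ^ n` of a prime `p`:
`a - b` is `p ^ n` times a rational number whose reduced denominator is prime to `p`
(that is, times a rational `p`-adic integer). -/
def RatModEqPrimePow (p n : ℕ) (a b : ℚ) : Prop :=
  ∃ r : ℚ, ¬ p ∣ r.den ∧ a - b = (p : ℚ) ^ n * r

/-! Linearising the squares of `legendreCoeff k n` by `legendreCoeff_mul` makes the sum over `n`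
telescope, leaving `p` times a double sum needed only mod `p ^ 2`. There `C(p-1,j) C(p+j,j)` becomes
`(-1) ^ j`, and the inner sum is a signed Legendre-coefficient sum in closed form. What remains, `∑
C(2k,k) (2k+1)(2k+3)`, reduces after multiplication by 3 to `∑ C(2k,k)`, which is `(p/3)` mod `p ^
2`. -/

theorem choose_succ_mul_int (n k : ℕ) :
    (n.choose (k + 1) : ℤ) * (k + 1) = n.choose k * (n - k) := by
  rcases le_or_gt k n with h | h
  · have := Nat.choose_succ_right_eq n k
    zify [h] at this
    exact this
  · simp [Nat.choose_eq_zero_of_lt h, Nat.choose_eq_zero_of_lt (Nat.lt_succ_of_lt h)]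

theorem succ_choose_succ_mul_int (n k : ℕ) :
    ((n + 1).choose (k + 1) : ℤ) * (k + 1) = (n + 1) * n.choose k := by
  exact_mod_cast (Nat.add_one_mul_choose_eq n k).symm

theorem succ_choose_mul_int (n k : ℕ) :
    ((n + 1).choose k : ℤ) * (n + 1 - k) = n.choose k * (n + 1) := by
  rcases le_or_gt k (n + 1) with h | h
  · have := Nat.choose_mul_succ_eq n k
    zify [h] at this
    exact this.symm
  · simp [Nat.choose_eq_zero_of_lt h, Nat.choose_eq_zero_of_lt (by omega : n < k)]

/-- The product `C(n,j) C(n+j,j)`, a polynomial of degree `j` in `n (n + 1)`. -/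
def legendreCoeff (j n : ℕ) : ℤ := n.choose j * (n + j).choose j

theorem legendreCoeff_succ_right (j n : ℕ) :
    legendreCoeff j (n + 1) * (n + 1 - j) = legendreCoeff j n * (n + 1 + j) := by
  have h1 := succ_choose_mul_int n j
  have h2 := succ_choose_mul_int (n + j) j
  rw [show n + j + 1 = n + 1 + j by ring] at h2
  push_cast at h2
  unfold legendreCoeff
  linear_combination ((n + 1 + j).choose j : ℤ) * h1 + (n.choose j : ℤ) * h2

theorem legendreCoeff_succ_left (j n : ℕ) :
    legendreCoeff (j + 1) n * (j + 1) ^ 2 =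
      legendreCoeff j n * (n * (n + 1) - j * (j + 1)) := by
  have h1 := choose_succ_mul_int n j
  have h2 := succ_choose_succ_mul_int (n + j) j
  rw [show n + j + 1 = n + (j + 1) by ring] at h2
  push_cast at h2
  unfold legendreCoeff
  linear_combination ((n + (j + 1)).choose (j + 1) : ℤ) * (j + 1) * h1 +
    (n.choose j : ℤ) * (n - j) * h2

theorem legendreCoeff_zero_left (n : ℕ) : legendreCoeff 0 n = 1 := by
  simp [legendreCoeff]

theorem legendreCoeff_eq_zero {j n : ℕ} (h : n < j) : legendreCoeff j n = 0 := by
  simp [legendreCoeff, Nat.choose_eq_zero_of_lt h]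

/-- The coefficients expanding `C(n,k) C(n+k,k) C(n,l) C(n+l,l)` in the products
`C(n,k+i) C(n+k+i,k+i)`. -/
def linCoeff (k l i : ℕ) : ℤ := (k + l).choose l * l.choose i * (k + i).choose l

theorem linCoeff_succ_zero (k l : ℕ) :
    linCoeff k (l + 1) 0 * (l + 1) ^ 2 =
      linCoeff k l 0 * (k * (k + 1) - l * (l + 1)) := by
  have h1 := succ_choose_succ_mul_int (k + l) l
  have h2 := choose_succ_mul_int k l
  rw [show k + l + 1 = k + (l + 1) by ring] at h1
  push_cast at h1
  simp only [linCoeff, Nat.choose_zero_right, Nat.add_zero, Nat.cast_one, mul_one]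
  linear_combination (k.choose (l + 1) : ℤ) * (l + 1) * h1 +
    ((k + l).choose l : ℤ) * (k + l + 1) * h2

theorem linCoeff_succ_succ (k l i : ℕ) :
    linCoeff k (l + 1) (i + 1) * (l + 1) ^ 2 =
      linCoeff k l i * (k + i + 1) ^ 2 +
        linCoeff k l (i + 1) * ((k + i + 1) * (k + i + 2) - l * (l + 1)) := by
  have h1 := succ_choose_succ_mul_int (k + l) l
  have h2 := choose_succ_mul_int (k + i + 1) l
  have h3 := succ_choose_mul_int (k + i) l
  have h4 := choose_succ_mul_int l i
  have h5 : ((l + 1).choose (i + 1) : ℤ) = l.choose i + l.choose (i + 1) := by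
    exact_mod_cast Nat.choose_succ_succ l i
  rw [show k + l + 1 = k + (l + 1) by ring] at h1
  rw [show k + i + 1 = k + (i + 1) by ring] at h2 h3
  push_cast at h1 h2 h3
  unfold linCoeff
  rw [h5]
  set A : ℤ := ((k + l).choose l : ℤ)
  set B : ℤ := ((k + (i + 1)).choose l : ℤ)
  set C : ℤ := ((k + i).choose l : ℤ)
  set D : ℤ := (l.choose i : ℤ)
  set E : ℤ := (l.choose (i + 1) : ℤ)
  linear_combination (D + E) * ((k + (i + 1)).choose (l + 1) : ℤ) * (l + 1) * h1 +
    A * (D + E) * (k + l + 1) * h2 + A * D * (k + i + 1) * h3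
    - A * B * (k + i + 1 - l) * h4

-- Induction on `l`: the factor `n(n+1) - l(l+1)` splits as `n(n+1) - (k+i)(k+i+1)`, which raises
-- the index `k+i`, plus a part free of `n`.
open Finset in
theorem legendreCoeff_mul (k l n : ℕ) :
    legendreCoeff k n * legendreCoeff l n =
      ∑ i ∈ range (l + 1), linCoeff k l i * legendreCoeff (k + i) n := by
  induction l with
  | zero => simp [legendreCoeff_zero_left, linCoeff]
  | succ l ih =>
    have hl : ((l : ℤ) + 1) ^ 2 ≠ 0 := by positivity
    apply mul_right_cancel₀ hl
    rw [mul_assoc, legendreCoeff_succ_left, ← mul_assoc, ih, sum_mul, sum_mul,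
      sum_range_succ' _ (l + 1)]
    have key : ∀ i, linCoeff k l i * legendreCoeff (k + i) n * ((n : ℤ) * (n + 1) - l * (l + 1)) =
        linCoeff k l i * (k + i + 1) ^ 2 * legendreCoeff (k + i + 1) n +
        linCoeff k l i * ((k + i) * (k + i + 1) - l * (l + 1)) * legendreCoeff (k + i) n := by
      intro i
      have := legendreCoeff_succ_left (k + i) n
      push_cast at this
      linear_combination -linCoeff k l i * this
    have key2 : ∀ i, linCoeff k (l + 1) (i + 1) * legendreCoeff (k + (i + 1)) n * ((l : ℤ) + 1) ^ 2 =
        linCoeff k l i * (k + i + 1) ^ 2 * legendreCoeff (k + i + 1) n +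
        linCoeff k l (i + 1) * ((k + i + 1) * (k + i + 2) - l * (l + 1)) *
          legendreCoeff (k + i + 1) n := by
      intro i
      rw [← add_mul, ← linCoeff_succ_succ, add_assoc]
      ring
    simp_rw [key, key2, sum_add_distrib]
    rw [add_assoc]
    congr 1
    have hz : linCoeff k (l + 1) 0 * legendreCoeff (k + 0) n * ((l : ℤ) + 1) ^ 2 =
        linCoeff k l 0 * (k * (k + 1) - l * (l + 1)) * legendreCoeff k n := by
      rw [← linCoeff_succ_zero, add_zero]
      ring
    rw [hz, sum_range_succ', sum_range_succ _ l]
    have ht : linCoeff k l (l + 1) = 0 := by simp [linCoeff]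
    rw [ht]
    simp only [zero_mul, add_zero, Nat.cast_zero]
    congr 1

/-! ### Alternating sums of Legendre coefficients -/

open Finset in
theorem sum_alternating_cube_mul_legendreCoeff (j m : ℕ) :
    ∑ n ∈ range m, (2 * (n : ℤ) + 1) ^ 3 * (-1) ^ n * legendreCoeff j n =
      -(-1) ^ m * (m - j) * legendreCoeff j m * (4 * m ^ 2 - 4 * j - 3) := by
  induction m with
  | zero =>
    rcases Nat.eq_zero_or_pos j with rfl | h
    · simp
    · simp [legendreCoeff_eq_zero h]
  | succ m ih =>
    rw [sum_range_succ, ih]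
    have := legendreCoeff_succ_right j m
    push_cast
    linear_combination -(-1 : ℤ) ^ m * (4 * (m + 1) ^ 2 - 4 * j - 3) * this

-- The shifted Legendre polynomial at 1, found from its value at 0 by the symmetry `x ↦ 1 - x`.
open Finset Polynomial in
theorem sum_alternating_legendreCoeff (k : ℕ) :
    ∑ i ∈ range (k + 1), (-1) ^ i * legendreCoeff i k = (-1) ^ k := by
  have h0 : aeval (0 : ℤ) (shiftedLegendre k) = 1 := by
    rw [← coeff_zero_eq_aeval_zero, coeff_shiftedLegendre]
    simp
  have h := shiftedLegendre_eval_symm k (1 : ℤ)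
  rw [sub_self, h0, mul_one, shiftedLegendre] at h
  simpa [legendreCoeff, fun i => Nat.choose_symm_add (a := k) (b := i), mul_assoc] using h

open Finset in
theorem sum_range_sub_mul_alternating_legendreCoeff (k m : ℕ) :
    ∑ i ∈ range m, ((i : ℤ) - k * (k + 1)) * ((-1) ^ i * legendreCoeff i k) =
      m ^ 2 * ((-1) ^ m * legendreCoeff m k) := by
  induction m with
  | zero => simp
  | succ m ih =>
    rw [sum_range_succ, ih]
    have := legendreCoeff_succ_left m k
    push_cast
    linear_combination (-1 : ℤ) ^ m * this

open Finset in
theorem sum_alternating_legendreCoeff_mul_linear (k : ℕ) :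
    ∑ i ∈ range (k + 1), (-1) ^ i * legendreCoeff i k * (4 * ((k + i : ℕ) : ℤ) + 3) =
      (-1) ^ k * ((2 * k + 1) * (2 * k + 3)) := by
  have h1 := sum_alternating_legendreCoeff k
  have h2 := sum_range_sub_mul_alternating_legendreCoeff k (k + 1)
  rw [legendreCoeff_eq_zero (Nat.lt_succ_self k)] at h2
  -- The weight is split so that its first part sums to zero by `h2`.
  calc _ = ∑ i ∈ range (k + 1), (4 * (((i : ℤ) - k * (k + 1)) * ((-1) ^ i * legendreCoeff i k)) +
        ((2 * k + 1) * (2 * k + 3)) * ((-1) ^ i * legendreCoeff i k)) := by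
        refine sum_congr rfl fun i _ => ?_
        push_cast
        ring
    _ = _ := by
        rw [sum_add_distrib, ← mul_sum, ← mul_sum, h1, h2]
        ring

/-! ### Sums of central binomial coefficients -/

open Finset in
theorem three_mul_sum_centralBinom_mul (n : ℕ) :
    3 * ∑ k ∈ range n, (k.centralBinom : ℤ) * ((2 * k + 1) * (2 * k + 3)) =
      4 * n ^ 2 * n.centralBinom + ∑ k ∈ range n, (k.centralBinom : ℤ) := by
  induction n with
  | zero => simp
  | succ n ih =>
    rw [sum_range_succ, sum_range_succ, mul_add, ih]
    have : ((n : ℤ) + 1) * (n + 1).centralBinom = 2 * (2 * n + 1) * n.centralBinom := by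
      exact_mod_cast Nat.succ_mul_centralBinom_succ n
    push_cast
    linear_combination -4 * ((n : ℤ) + 1) * this

theorem legendreSym_three_add (a : ℤ) :
    legendreSym 3 (a - 1) + legendreSym 3 a + legendreSym 3 (a + 1) = 0 := by
  have : ∀ x : ZMod 3, quadraticChar (ZMod 3) (x - 1) + quadraticChar (ZMod 3) x +
      quadraticChar (ZMod 3) (x + 1) = 0 := by decide
  simpa [legendreSym] using this a

open Finset in
theorem sum_legendreSym_three_mul_choose (n : ℕ) (s : ℤ) :
    ∑ j ∈ range (n + 1), legendreSym 3 (j + s) * n.choose j = (-1) ^ n * legendreSym 3 (s - n) := by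
  induction n generalizing s with
  | zero => simp
  | succ n ih =>
    have h1 := ih s
    have h2 := ih (s + 1)
    have h3 := legendreSym_three_add (s - n)
    rw [sum_range_succ']
    simp only [Nat.choose_succ_succ, Nat.cast_add, mul_add, sum_add_distrib]
    rw [sum_range_succ (fun j : ℕ => _ * ((n.choose (j + 1) : ℕ) : ℤ)) n]
    rw [sum_range_succ'] at h1
    have e1 : ∀ j : ℕ, ((j + 1 : ℕ) : ℤ) + s = j + (s + 1) := by intro j; push_cast; ring
    simp only [e1] at h1
    simp only [Nat.cast_add, Nat.cast_one] at e1
    simp only [Nat.cast_one, e1, h2]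
    simp at h1 ⊢
    rw [show s - ((n : ℤ) + 1) = s - n - 1 by ring]
    rw [show s + 1 - (n : ℤ) = s - n + 1 by ring]
    linear_combination h1 + (-1 : ℤ) ^ n * h3

open Finset in
theorem sum_legendreSym_three_mul_telescope (e : ℕ → ℤ) (N : ℕ) :
    ∑ j ∈ range N, legendreSym 3 (j + 1) * (e (j + 2) + e (j + 1) + e j) =
      e 0 + legendreSym 3 N * e (N + 1) - legendreSym 3 (N + 1) * e N := by
  induction N with
  | zero => simp
  | succ N ih =>
    have h := legendreSym_three_add (N + 1)
    rw [add_sub_cancel_right] at h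
    rw [sum_range_succ, ih]
    push_cast
    linear_combination e (N + 1) * h

-- Applying Pascal's rule twice, the increment in `n` is a sum of three consecutive binomials
-- weighted by the character mod 3; it telescopes to `C(2n,n)`, and `n ≤ N` kills the boundary
-- terms.
open Finset in
theorem sum_centralBinom_eq (N n : ℕ) (h : n ≤ N) :
    ∑ k ∈ range n, (k.centralBinom : ℤ) =
      ∑ j ∈ range N, legendreSym 3 (j + 1) * ((2 * n).choose (n + (j + 1)) : ℤ) := by
  induction n with
  | zero => simp
  | succ n ih =>
    have key := sum_legendreSym_three_mul_telescope (fun j => ((2 * n).choose (n + j) : ℤ)) N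
    have z1 : (2 * n).choose (n + (N + 1)) = 0 := Nat.choose_eq_zero_of_lt (by omega)
    have z2 : (2 * n).choose (n + N) = 0 := Nat.choose_eq_zero_of_lt (by omega)
    simp only [z1, z2, Nat.cast_zero, mul_zero, add_zero, sub_zero] at key
    rw [sum_range_succ, ih (by omega), Nat.centralBinom, ← key, ← sum_add_distrib]
    refine sum_congr rfl fun j _ => ?_
    have : (2 * (n + 1)).choose (n + 1 + (j + 1)) =
        (2 * n).choose (n + j) + 2 * (2 * n).choose (n + (j + 1)) +
          (2 * n).choose (n + (j + 2)) := by
      rw [show 2 * (n + 1) = 2 * n + 1 + 1 by ring,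
        show n + 1 + (j + 1) = n + j + 1 + 1 by ring, Nat.choose_succ_succ,
        Nat.choose_succ_succ, Nat.choose_succ_succ, ← add_assoc n j 1, ← add_assoc n j 2]
      simp only [Nat.succ_eq_add_one]
      ring
    rw [this]
    push_cast
    ring

-- In Vandermonde's convolution every term but the two extreme ones is a product of two multiples of
-- `p`.
open Finset in
theorem choose_two_mul_modEq {p m : ℕ} (hp : p.Prime) (h0 : 0 < m) (hm : m < p) :
    ((2 * p).choose m : ℤ) ≡ 2 * p.choose m [ZMOD p ^ 2] := by
  obtain ⟨q, rfl⟩ := Nat.exists_eq_add_one.mpr h0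
  rw [two_mul p, Nat.add_choose_eq, Nat.sum_antidiagonal_eq_sum_range_succ_mk, sum_range_succ,
    sum_range_succ']
  simp only [Nat.choose_zero_right, Nat.sub_zero, Nat.sub_self, mul_one, one_mul]
  have hd : p ^ 2 ∣ ∑ a ∈ range q, p.choose (a + 1) * p.choose (q + 1 - (a + 1)) := by
    refine dvd_sum fun a ha => ?_
    have := mem_range.mp ha
    rw [pow_two]
    exact mul_dvd_mul (hp.dvd_choose_self (by omega) (by omega))
      (hp.dvd_choose_self (by omega) (by omega))
  obtain ⟨c, hc⟩ := hd
  rw [hc]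
  refine (Int.modEq_iff_dvd.mpr ⟨-c, ?_⟩)
  push_cast
  ring

open Finset in
theorem sum_centralBinom_modEq {p : ℕ} (hp : p.Prime) (hp2 : p ≠ 2) :
    ∑ k ∈ range p, (k.centralBinom : ℤ) ≡ legendreSym 3 p [ZMOD p ^ 2] := by
  have hodd : Odd p := hp.odd_of_ne_two hp2
  obtain ⟨q, rfl⟩ := Nat.exists_eq_add_one.mpr hp.pos
  have hneg : legendreSym 3 (-((q + 1 : ℕ) : ℤ)) = -legendreSym 3 ((q + 1 : ℕ) : ℤ) := by
    have : ∀ x : ZMod 3, quadraticChar (ZMod 3) (-x) = -quadraticChar (ZMod 3) x := by decide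
    simpa [legendreSym] using this ((q + 1 : ℕ) : ZMod 3)
  have h := sum_legendreSym_three_mul_choose (q + 1) 0
  rw [sum_range_succ, sum_range_succ', zero_sub, hneg, hodd.neg_one_pow] at h
  simp only [add_zero, Nat.cast_zero, legendreSym.at_zero, zero_mul, Nat.choose_self, Nat.cast_one,
    mul_one] at h
  -- Oddness of `p` and of the character makes the top term cancel the right side, so only the final
  -- `C(2p,2p) = 1` term survives below.
  have h' : ∑ j ∈ range q, legendreSym 3 (j + 1) * ((q + 1).choose (j + 1) : ℤ) = 0 := by
    push_cast at h ⊢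
    linarith
  rw [sum_centralBinom_eq (q + 1) (q + 1) le_rfl, sum_range_succ,
    show q + 1 + (q + 1) = 2 * (q + 1) by ring, Nat.choose_self]
  have hs : ∑ j ∈ range q, legendreSym 3 (j + 1) *
      ((2 * (q + 1)).choose (q + 1 + (j + 1)) : ℤ) ≡
      ∑ j ∈ range q, legendreSym 3 (j + 1) * (2 * ((q + 1).choose (j + 1) : ℤ))
        [ZMOD ((q + 1 : ℕ) : ℤ) ^ 2] := by
    refine Int.ModEq.sum fun j hj => Int.ModEq.mul_left _ ?_
    have hj := mem_range.mp hj
    rw [← Nat.choose_symm (by omega : q + 1 + (j + 1) ≤ 2 * (q + 1)),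
      ← Nat.choose_symm (by omega : j + 1 ≤ q + 1),
      show 2 * (q + 1) - (q + 1 + (j + 1)) = q + 1 - (j + 1) by omega]
    exact choose_two_mul_modEq hp (by omega) (by omega)
  have hz : ∑ j ∈ range q, legendreSym 3 (j + 1) * (2 * ((q + 1).choose (j + 1) : ℤ)) = 0 := by
    simp_rw [mul_left_comm _ (2 : ℤ)]
    rw [← mul_sum, h', mul_zero]
  rw [hz] at hs
  simpa using hs.add_right (legendreSym 3 ((q : ℤ) + 1) * 1)

/-! ### Reduction modulo powers of `p` -/

/-- The product is `∏ (p² - i²) / i²` over `1 ≤ i ≤ j`, with each `i` prime to `p`. -/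
theorem choose_mul_choose_modEq {p j : ℕ} (hp : p.Prime) (hj : j < p) :
    ((p - 1).choose j : ℤ) * (p + j).choose j ≡ (-1) ^ j [ZMOD p ^ 2] := by
  induction j with
  | zero => simp
  | succ j ih =>
    have h1 := choose_succ_mul_int (p - 1) j
    have h2 := succ_choose_succ_mul_int (p + j) j
    push_cast [hp.one_le] at h1 h2
    rw [show p + j + 1 = p + (j + 1) by ring] at h2
    have hc : IsCoprime ((p : ℤ) ^ 2) (((j : ℤ) + 1) ^ 2) := by
      apply IsCoprime.pow
      have : Nat.Coprime p (j + 1) := Nat.coprime_of_lt_prime j.succ_ne_zero hj hp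
      exact_mod_cast Nat.isCoprime_iff_coprime.mpr this
    obtain ⟨c, hc'⟩ := (ih (by omega)).dvd
    refine Int.modEq_iff_dvd.mpr (hc.dvd_of_dvd_mul_right
      ⟨c * (p ^ 2 - (j + 1) ^ 2) - (-1) ^ j, ?_⟩)
    linear_combination (p ^ 2 - (j + 1) ^ 2 : ℤ) * hc' -
      ((p + (j + 1)).choose (j + 1) : ℤ) * (j + 1) * h1 -
      ((p - 1).choose j : ℤ) * (p - 1 - j) * h2

open Finset in
theorem sum_cube_mul_apery_eq {p : ℕ} (hp : p.Prime) (hp2 : p ≠ 2) :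
    ∑ n ∈ range p, (2 * (n : ℤ) + 1) ^ 3 * (-1) ^ n * (aperyNumber n : ℤ) =
      (p : ℤ) * ∑ k ∈ range p, ∑ i ∈ range (k + 1), linCoeff k k i *
        (((p - 1).choose (k + i) : ℤ) * (p + (k + i)).choose (k + i) *
          (4 * p ^ 2 - 4 * ((k + i : ℕ) : ℤ) - 3)) := by
  have hA : ∀ n ∈ range p, (aperyNumber n : ℤ) =
      ∑ k ∈ range p, ∑ i ∈ range (k + 1), linCoeff k k i * legendreCoeff (k + i) n := by
    intro n hn
    have hn := mem_range.mp hn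
    simp_rw [← legendreCoeff_mul]
    rw [aperyNumber, Nat.cast_sum]
    rw [← sum_subset (range_subset_range.mpr (by omega : n + 1 ≤ p))]
    · refine sum_congr rfl fun k _ => ?_
      simp only [legendreCoeff]
      push_cast
      ring
    · intro k _ hk
      rw [legendreCoeff_eq_zero (by simpa using hk), zero_mul]
  have hS := sum_congr rfl fun (n : ℕ) hn =>
    congrArg (fun x => (2 * (n : ℤ) + 1) ^ 3 * (-1) ^ n * x) (hA n hn)
  refine hS.trans ?_
  simp_rw [mul_sum]
  rw [sum_comm]
  refine sum_congr rfl fun k _ => ?_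
  rw [sum_comm]
  refine sum_congr rfl fun i _ => ?_
  have h1 := sum_alternating_cube_mul_legendreCoeff (k + i) p
  have h2 := succ_choose_mul_int (p - 1) (k + i)
  rw [Nat.sub_add_cancel hp.one_le] at h2
  push_cast [hp.one_le] at h2
  rw [(hp.odd_of_ne_two hp2).neg_one_pow] at h1
  calc _ = linCoeff k k i * ∑ n ∈ range p,
        (2 * (n : ℤ) + 1) ^ 3 * (-1) ^ n * legendreCoeff (k + i) n := by
        rw [mul_sum]
        exact sum_congr rfl fun n _ => by ring
    _ = _ := by
        rw [h1, legendreCoeff]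
        push_cast
        linear_combination linCoeff k k i * ((p + (k + i)).choose (k + i) : ℤ) *
          (4 * p ^ 2 - 4 * (k + i) - 3) * h2

theorem linCoeff_self (k i : ℕ) :
    linCoeff k k i = k.centralBinom * legendreCoeff i k := by
  rw [linCoeff, legendreCoeff, Nat.centralBinom, two_mul, Nat.choose_symm_add (a := k) (b := i)]
  ring

theorem linCoeff_self_mul_modEq {p k i : ℕ} (hp : p.Prime) (hk : k < p) (hi : i ≤ k) :
    linCoeff k k i * (((p - 1).choose (k + i) : ℤ) * (p + (k + i)).choose (k + i)) ≡
      linCoeff k k i * (-1) ^ (k + i) [ZMOD p ^ 2] := by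
  rcases lt_or_ge (k + i) p with h | h
  · exact (choose_mul_choose_modEq hp h).mul_left _
  -- Beyond the range of the previous congruence, two binomials in `linCoeff` each supply a factor
  -- `p`.
  · have h1 : (p : ℤ) ∣ ((k + k).choose k : ℤ) := by
      exact_mod_cast hp.dvd_choose_add hk hk (by omega)
    have h2 : (p : ℤ) ∣ ((k + i).choose k : ℤ) := by
      exact_mod_cast hp.dvd_choose_add hk (by omega) h
    have hd : (p : ℤ) ^ 2 ∣ linCoeff k k i := by
      rw [pow_two, linCoeff]
      exact mul_dvd_mul (h1.mul_right _) h2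
    have h0 := Int.modEq_zero_iff_dvd.mpr hd
    exact ((h0.mul_right _).trans (by rw [zero_mul, zero_mul])).trans (h0.mul_right _).symm

open Finset in
theorem three_mul_sum_cube_mul_apery_modEq {p : ℕ} (hp : p.Prime) (hp2 : p ≠ 2) :
    3 * ∑ n ∈ range p, (2 * (n : ℤ) + 1) ^ 3 * (-1) ^ n * (aperyNumber n : ℤ) ≡
      -p * legendreSym 3 p [ZMOD p ^ 3] := by
  rw [sum_cube_mul_apery_eq hp hp2]
  set U : ℤ := ∑ k ∈ range p, ∑ i ∈ range (k + 1), linCoeff k k i *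
        (((p - 1).choose (k + i) : ℤ) * (p + (k + i)).choose (k + i) *
          (4 * p ^ 2 - 4 * ((k + i : ℕ) : ℤ) - 3)) with hU
  have h1 : U ≡ -∑ k ∈ range p, (k.centralBinom : ℤ) * ((2 * k + 1) * (2 * k + 3))
      [ZMOD p ^ 2] := by
    rw [hU, ← sum_neg_distrib]
    refine Int.ModEq.sum fun k hk => ?_
    have hrhs : -((k.centralBinom : ℤ) * ((2 * k + 1) * (2 * k + 3))) =
        ∑ i ∈ range (k + 1), linCoeff k k i * (-1) ^ (k + i) *
          (-(4 * ((k + i : ℕ) : ℤ) + 3)) := by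
      have h := sum_alternating_legendreCoeff_mul_linear k
      have hs : ((-1 : ℤ) ^ k) * (-1) ^ k = 1 := by rw [← mul_pow]; simp
      calc _ = -(k.centralBinom : ℤ) * (-1) ^ k * ((-1) ^ k * ((2 * k + 1) * (2 * k + 3))) := by
            linear_combination (k.centralBinom : ℤ) * ((2 * k + 1) * (2 * k + 3)) * hs
        _ = _ := by
            rw [← h, mul_sum]
            refine sum_congr rfl fun i _ => ?_
            rw [linCoeff_self, pow_add]
            ring
    rw [hrhs]
    refine Int.ModEq.sum fun i hi => ?_
    rw [← mul_assoc]
    refine (linCoeff_self_mul_modEq hp (mem_range.mp hk) (by simpa [Nat.lt_succ_iff] using hi)).mul ?_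
    exact Int.modEq_iff_dvd.mpr ⟨-4, by ring⟩
  have h2 : 3 * U ≡ -legendreSym 3 p [ZMOD p ^ 2] := by
    have h3 := three_mul_sum_centralBinom_mul p
    calc 3 * U ≡ 3 * -∑ k ∈ range p, (k.centralBinom : ℤ) * ((2 * k + 1) * (2 * k + 3))
          [ZMOD p ^ 2] := h1.mul_left _
      _ = -∑ k ∈ range p, (k.centralBinom : ℤ) + p ^ 2 * (-4 * p.centralBinom) := by
          linear_combination -h3
      _ ≡ -∑ k ∈ range p, (k.centralBinom : ℤ) [ZMOD p ^ 2] :=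
          Int.modEq_iff_dvd.mpr ⟨4 * p.centralBinom, by ring⟩
      _ ≡ _ [ZMOD p ^ 2] := (sum_centralBinom_modEq hp hp2).neg
  obtain ⟨c, hc⟩ := h2.dvd
  exact Int.modEq_iff_dvd.mpr ⟨c, by linear_combination (p : ℤ) * hc⟩

theorem corollary2p2 (p : ℕ) (hp : p.Prime) (hp3 : 3 < p) :
    RatModEqPrimePow p 3
      (∑ k ∈ Finset.range p,
        (2 * (k : ℚ) + 1) ^ 3 * (-1 : ℚ) ^ k * (aperyNumber k : ℚ))
      (-((p : ℚ) / 3) * (legendreSym 3 (p : ℤ) : ℚ)) := by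
  obtain ⟨c, hc⟩ := (three_mul_sum_cube_mul_apery_modEq hp (by omega)).dvd
  refine ⟨-(c / 3 : ℚ), fun h => ?_, ?_⟩
  -- Dividing by 3 is harmless: the denominator of `c / 3` divides 3, and `p > 3`.
  · rw [Rat.den_neg_eq_den] at h
    have h3 : ((c / 3 : ℚ).den : ℤ) ∣ 3 := by
      have := Rat.den_dvd c 3
      rwa [Rat.divInt_eq_div, Int.cast_ofNat] at this
    have h3 : (c / 3 : ℚ).den ∣ 3 := by exact_mod_cast h3
    exact absurd (Nat.le_of_dvd (by norm_num) (h.trans h3)) (by omega)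
  · have hq := congrArg (Int.cast : ℤ → ℚ) hc
    push_cast at hq
    linear_combination -(1 / 3 : ℚ) * hq
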